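/- Let $\mathbb{D}$ be the open unit disk in $\mathbb{C}$. An inner function is a bounded holomorphic function $\varphi$ on $\mathbb{D}$ whose radial limits $\lim_{r\to1^-}\varphi(re^{it})$ exist and have modulus $1$ for almost every $t\in(0,2\pi]$. Two inner functions $\varphi,\psi$ are relatively prime if every inner function $u$ for which $\varphi=uh$ and $\psi=uk$ with bounded holomorphic functions $h,k$ on $\mathbb{D}$ is constant. For inner functions $\varphi,\psi$ consider the conditions (S) $\displaystyle\lim_{|z|\to1^-}\max\{|\varphi(z)|,|\psi(z)|\}=1$; (C) $\displaystyle\inf_{z\in\mathbb{D}}\bigl(|\varphi(z)|+|\psi(z)|\bigr)>0$. Then for all relatively prime inner functions $\varphi,\psi$, condition (S) implies condition (C). The converse is false: the Blaschke products $$B_1(z)=\prod_{n=1}^\infty\frac{a_n-z}{1-a_nz},\qquad B_2(z)=\prod_{n=1}^\infty\frac{b_n-z}{1-b_nz}\qquad(z\in\mathbb{D}),$$ with zeros $a_n=1-4^{-n}$ and $b_n=1-2\cdot4^{-n}$, $n\ge1$, satisfy $\sum_n(1-a_n)<\infty$ and $\sum_n(1-b_n)<\infty$, converge on $\mathbb{D}$,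 and are relatively prime inner functions which satisfy (C) but not (S). -/

import Mathlib

noncomputable section

namespace DiskInner

/-- The open unit disk of the complex plane. -/
def disk : Set ℂ := Metric.ball (0 : ℂ) 1

/-- `f` restricts to an element of the algebra of bounded holomorphic functions on the disk.
Only the values of `f` on the disk matter. -/
structure IsHInfty (f : ℂ → ℂ) : Prop where
  holomorphic : DifferentiableOn ℂ f disk
  bounded : ∃ M : ℝ, ∀ z ∈ disk, ‖f z‖ ≤ M

/-- `f` is an inner function: bounded and holomorphic on the disk, with radial limits of modulus
one at almost every point `exp (i t)` of the unit circle. -/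
structure IsInner (f : ℂ → ℂ) : Prop where
  isHInfty : IsHInfty f
  radial : ∀ᵐ t : ℝ ∂(MeasureTheory.volume.restrict (Set.Ioc 0 (2 * Real.pi))),
    ∃ w : ℂ, ‖w‖ = 1 ∧
      Filter.Tendsto (fun r : ℝ => f (circleMap 0 r t)) (nhdsWithin 1 (Set.Iio 1)) (nhds w)

/-- `g` divides `f` in the algebra of bounded holomorphic functions on the disk. -/
def DividesHInfty (g f : ℂ → ℂ) : Prop :=
  ∃ h : ℂ → ℂ, IsHInfty h ∧ ∀ z ∈ disk, f z = g z * h z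

/-- Two inner functions are relatively prime if all their common inner divisors are constant. -/
def RelativelyPrime (φ ψ : ℂ → ℂ) : Prop :=
  ∀ u : ℂ → ℂ, IsInner u → DividesHInfty u φ → DividesHInfty u ψ →
    ∃ c : ℂ, ∀ z ∈ disk, u z = c

/-- `max (|φ z|, |ψ z|)` tends to `1` as `|z|` tends to `1` from inside the disk. -/
def ConditionS (φ ψ : ℂ → ℂ) : Prop :=
  Filter.Tendsto (fun z : ℂ => max ‖φ z‖ ‖ψ z‖)
    (Filter.comap (fun z : ℂ => ‖z‖) (nhdsWithin 1 (Set.Iio 1))) (nhds 1)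

/-- The corona condition: the infimum of `|φ| + |ψ|` over the disk is positive. -/
def ConditionC (φ ψ : ℂ → ℂ) : Prop :=
  0 < ⨅ z : disk, (‖φ z‖ + ‖ψ z‖)

/-- The normalized Blaschke factor vanishing at `a`. -/
def blaschkeFactor (a z : ℂ) : ℂ :=
  if a = 0 then z
  else ((‖a‖ : ℂ) / a) * ((a - z) / (1 - (starRingEnd ℂ) a * z))

/-- `B` is, on the disk, the (convergent) Blaschke product with zero sequence `a`. -/
structure IsBlaschkeProduct (a : ℕ → ℂ) (B : ℂ → ℂ) : Prop where
  mem_disk : ∀ n, a n ∈ disk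
  summable : Summable fun n => 1 - ‖a n‖
  hasProd : ∀ z ∈ disk, HasProd (fun n => blaschkeFactor (a n) z) (B z)

end DiskInner

end

/-!
# The corona condition for relatively prime inner functions

**(S) implies (C).** If `φ` and `ψ` had a common zero `a`, the disk automorphism `diskAut a` would
be a nonconstant common inner divisor (`IsHInfty.dividesHInfty_diskAut`). So `|φ| + |ψ|` has no zero
in the disk; it has a positive minimum on each closed disk `|z| ≤ r < 1`, and (S) bounds it below on
some annulus `r < |z| < 1`.

**(C) implies relative primeness.** A common inner divisor `u` is bounded away from zero, so `1 / u`
is inner too. Inner functions are bounded by one (`IsInner.norm_le_one`): Cauchy's formula and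
dominated convergence give `(1 - |z|) |f z| ^ n ≤ 1` for every `n`. Hence `|u| = 1` throughout,
and `u` is constant by the maximum principle.

**The example.** For a real zero `a = 1 - ε` and `s = |1 - z|`, the Blaschke factor has modulus at
least `t = |s - ε| / (s + ε)`, and `1 - t ^ 2 = 4 s ε / (s + ε) ^ 2`. Along a geometric sequence of
`ε` the sum of these quantities is bounded uniformly in `s`, by telescoping (`sum_geometric_le`).
So a product is bounded below at every point for which all its `t` are at least `1 / 7`, and every
`s` has this property with respect to one of the sequences `4 ^ (-n)` and `2 * 4 ^ (-n)`
(`separated_or_separated`). This is (C), and relative primeness follows. Condition (S) fails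
along the zeros of the first product, where one factor of the second has modulus at most `2 / 5`.
That the products are inner needs no boundary theory: they converge uniformly on the closed disk
away from the point `1` (`hasProdUniformlyOn_realBlaschke`).
-/

namespace DiskInner

open Complex Filter Set Topology MeasureTheory

/-! ### The disk and its automorphisms -/

theorem mem_disk_iff {z : ℂ} : z ∈ disk ↔ ‖z‖ < 1 := by simp [disk]

theorem isOpen_disk : IsOpen disk := Metric.isOpen_ball

/-- The involutive automorphism `z ↦ (a - z) / (1 - conj a * z)` of the disk exchanging `a`
and `0`. -/
noncomputable def diskAut (a z : ℂ) : ℂ := (a - z) / (1 - (starRingEnd ℂ) a * z)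

theorem one_sub_conj_mul_ne_zero {a z : ℂ} (ha : ‖a‖ < 1) (hz : ‖z‖ ≤ 1) :
    1 - (starRingEnd ℂ) a * z ≠ 0 := by
  intro h
  have h1 : ‖(starRingEnd ℂ) a * z‖ = 1 := by rw [← sub_eq_zero.mp h, norm_one]
  rw [norm_mul, RCLike.norm_conj] at h1
  nlinarith [norm_nonneg a, norm_nonneg z]

theorem norm_one_sub_conj_mul_sq_sub (a z : ℂ) :
    ‖1 - (starRingEnd ℂ) a * z‖ ^ 2 - ‖a - z‖ ^ 2 = (1 - ‖a‖ ^ 2) * (1 - ‖z‖ ^ 2) := by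
  simp only [← normSq_eq_norm_sq, normSq_apply, sub_re, sub_im, mul_re, mul_im, conj_re, conj_im,
    one_re, one_im]
  ring

theorem norm_diskAut_le_one {a z : ℂ} (ha : ‖a‖ < 1) (hz : ‖z‖ ≤ 1) : ‖diskAut a z‖ ≤ 1 := by
  have h := norm_one_sub_conj_mul_sq_sub a z
  have h0 : 0 ≤ (1 - ‖a‖ ^ 2) * (1 - ‖z‖ ^ 2) := by
    apply mul_nonneg <;> nlinarith [norm_nonneg a, norm_nonneg z]
  rw [diskAut, norm_div]
  apply div_le_one_of_le₀ _ (norm_nonneg _)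
  exact le_of_sq_le_sq (by linarith) (norm_nonneg _)

theorem norm_diskAut_eq_one {a z : ℂ} (ha : ‖a‖ < 1) (hz : ‖z‖ = 1) : ‖diskAut a z‖ = 1 := by
  have h := norm_one_sub_conj_mul_sq_sub a z
  have h1 : ‖a - z‖ = ‖1 - (starRingEnd ℂ) a * z‖ := by
    rw [← sq_eq_sq₀ (norm_nonneg _) (norm_nonneg _)]
    rw [hz] at h
    linarith
  rw [diskAut, norm_div, h1]
  exact div_self (norm_ne_zero_iff.mpr (one_sub_conj_mul_ne_zero ha hz.le))

theorem continuousOn_diskAut {a : ℂ} (ha : ‖a‖ < 1) :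
    ContinuousOn (diskAut a) (Metric.closedBall 0 1) := by
  apply ContinuousOn.div (by fun_prop) (by fun_prop)
  intro z hz
  exact one_sub_conj_mul_ne_zero ha (by simpa using hz)

theorem differentiableOn_diskAut {a : ℂ} (ha : ‖a‖ < 1) : DifferentiableOn ℂ (diskAut a) disk := by
  apply DifferentiableOn.div (by fun_prop) (by fun_prop)
  intro z hz
  exact one_sub_conj_mul_ne_zero ha (mem_disk_iff.mp hz).le

/-! ### Radial limits -/

theorem tendsto_circleMap_radius (t : ℝ) :
    Tendsto (fun r : ℝ => circleMap 0 r t) (𝓝[<] 1) (𝓝 (circleMap 0 1 t)) := by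
  apply Tendsto.mono_left _ nhdsWithin_le_nhds
  have : Continuous fun r : ℝ => circleMap 0 r t := by
    unfold circleMap
    fun_prop
  exact this.tendsto 1

theorem eventually_radius_mem_Ioo {l : ℝ} (hl : l < 1) : ∀ᶠ r : ℝ in 𝓝[<] 1, r ∈ Ioo l 1 :=
  Ioo_mem_nhdsLT hl

theorem circleMap_mem_disk {r : ℝ} (hr : r ∈ Ioo (0 : ℝ) 1) (t : ℝ) : circleMap 0 r t ∈ disk := by
  rw [mem_disk_iff, norm_circleMap_zero, abs_of_pos hr.1]
  exact hr.2

theorem isInner_diskAut {a : ℂ} (ha : ‖a‖ < 1) : IsInner (diskAut a) where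
  isHInfty := ⟨differentiableOn_diskAut ha,
    1, fun _ hz => norm_diskAut_le_one ha (mem_disk_iff.mp hz).le⟩
  radial := by
    refine Eventually.of_forall fun t => ⟨diskAut a (circleMap 0 1 t),
      norm_diskAut_eq_one ha (by simp), ?_⟩
    have hc := continuousOn_diskAut ha (circleMap 0 1 t) (by simp)
    refine hc.tendsto.comp (tendsto_nhdsWithin_iff.mpr ⟨tendsto_circleMap_radius t, ?_⟩)
    filter_upwards [eventually_radius_mem_Ioo one_pos] with r hr
    exact Metric.ball_subset_closedBall (circleMap_mem_disk hr t)

/-! ### The condition (S) implies the corona condition -/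

/-- A bounded holomorphic function vanishing at `a` is divisible by `diskAut a`. -/
theorem IsHInfty.dividesHInfty_diskAut {f : ℂ → ℂ} (hf : IsHInfty f) {a : ℂ} (ha : a ∈ disk)
    (hfa : f a = 0) : DividesHInfty (diskAut a) f := by
  have ha1 := mem_disk_iff.mp ha
  have hd : DifferentiableOn ℂ (dslope f a) disk :=
    (differentiableOn_dslope (isOpen_disk.mem_nhds ha)).mpr hf.holomorphic
  obtain ⟨M, hM⟩ := hf.bounded
  obtain ⟨δ, hδ, hδd⟩ := Metric.nhds_basis_closedBall.mem_iff.mp (isOpen_disk.mem_nhds ha)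
  obtain ⟨C, hC⟩ := (isCompact_closedBall a δ).exists_bound_of_continuousOn
    (hd.continuousOn.mono hδd)
  have hM0 : 0 ≤ M := (norm_nonneg _).trans (hM a ha)
  have hC0 : 0 ≤ C := (norm_nonneg _).trans (hC a (Metric.mem_closedBall_self hδ.le))
  have hb : ∀ z ∈ disk, ‖dslope f a z‖ ≤ C + M / δ := by
    intro z hz
    rcases le_total (dist z a) δ with h | h
    · exact (hC z h).trans (le_add_of_nonneg_right (by positivity))
    · have hza : z ≠ a := dist_pos.mp (hδ.trans_le h)
      have h2 : ‖dslope f a z‖ ≤ M / δ := by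
        rw [dslope_of_ne _ hza, slope_def_field, hfa, sub_zero, norm_div, ← dist_eq_norm z a]
        exact div_le_div₀ hM0 (hM z hz) hδ h
      exact h2.trans (le_add_of_nonneg_left hC0)
  refine ⟨fun z => -(1 - (starRingEnd ℂ) a * z) * dslope f a z,
    ⟨DifferentiableOn.mul (by fun_prop) hd, 2 * (C + M / δ), fun z hz => ?_⟩, fun z hz => ?_⟩
  · rw [norm_mul, norm_neg]
    refine mul_le_mul ?_ (hb z hz) (norm_nonneg _) zero_le_two
    calc ‖1 - (starRingEnd ℂ) a * z‖ ≤ ‖(1 : ℂ)‖ + ‖(starRingEnd ℂ) a * z‖ := norm_sub_le _ _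
      _ ≤ 1 + 1 := by
        rw [norm_one, norm_mul, RCLike.norm_conj]
        nlinarith [norm_nonneg a, norm_nonneg z, mem_disk_iff.mp hz]
      _ = 2 := one_add_one_eq_two
  · have h1 := sub_smul_dslope f a z
    have h2 := one_sub_conj_mul_ne_zero ha1 (mem_disk_iff.mp hz).le
    rw [hfa, sub_zero, smul_eq_mul] at h1
    rw [diskAut, ← h1, div_mul_eq_mul_div, eq_div_iff h2]
    ring

theorem RelativelyPrime.not_common_zero {φ ψ : ℂ → ℂ} (h : RelativelyPrime φ ψ)
    (hφ : IsHInfty φ) (hψ : IsHInfty ψ) {a : ℂ} (ha : a ∈ disk) (hφa : φ a = 0) : ψ a ≠ 0 := by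
  intro hψa
  have ha1 := mem_disk_iff.mp ha
  obtain ⟨c, hc⟩ := h (diskAut a) (isInner_diskAut ha1) (hφ.dividesHInfty_diskAut ha hφa)
    (hψ.dividesHInfty_diskAut ha hψa)
  have hc0 : c = 0 := by rw [← hc a ha, diskAut, sub_self, zero_div]
  have hall : ∀ z ∈ disk, a = z := by
    intro z hz
    have := hc z hz
    rw [hc0, diskAut, div_eq_zero_iff] at this
    exact sub_eq_zero.mp (this.resolve_right
      (one_sub_conj_mul_ne_zero ha1 (mem_disk_iff.mp hz).le))
  have h0 := hall 0 (by simp [mem_disk_iff])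
  have h1 := hall (1 / 2) (by rw [mem_disk_iff]; norm_num)
  rw [h0] at h1
  norm_num at h1

instance : Nonempty disk := ⟨⟨0, by simp [disk]⟩⟩

theorem conditionC_iff {φ ψ : ℂ → ℂ} :
    ConditionC φ ψ ↔ ∃ δ > 0, ∀ z ∈ disk, δ ≤ ‖φ z‖ + ‖ψ z‖ := by
  constructor
  · intro h
    exact ⟨_, h, fun z hz => ciInf_le (f := fun z : disk => ‖φ z‖ + ‖ψ z‖)
      ⟨0, by rintro _ ⟨z, rfl⟩; positivity⟩ ⟨z, hz⟩⟩
  · rintro ⟨δ, hδ, h⟩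
    exact hδ.trans_le (le_ciInf fun z => h z z.2)

theorem ConditionS.conditionC {φ ψ : ℂ → ℂ} (hS : ConditionS φ ψ) (hφ : IsHInfty φ)
    (hψ : IsHInfty ψ) (h : RelativelyPrime φ ψ) : ConditionC φ ψ := by
  have h1 := hS.eventually (lt_mem_nhds (show (1 / 2 : ℝ) < 1 by norm_num))
  rw [eventually_comap] at h1
  obtain ⟨l, hl, hl1⟩ := (mem_nhdsLT_iff_exists_Ioo_subset' (zero_lt_one' ℝ)).mp h1
  have hl : l < 1 := hl
  have hr : max l 0 < 1 := max_lt hl one_pos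
  have hsub : Metric.closedBall (0 : ℂ) (max l 0) ⊆ disk := Metric.closedBall_subset_ball hr
  have hcont : ContinuousOn (fun z => ‖φ z‖ + ‖ψ z‖) (Metric.closedBall 0 (max l 0)) :=
    (hφ.holomorphic.continuousOn.mono hsub).norm.add (hψ.holomorphic.continuousOn.mono hsub).norm
  obtain ⟨w, hw, hmin⟩ := (isCompact_closedBall (0 : ℂ) (max l 0)).exists_isMinOn
    ⟨0, by simp⟩ hcont
  have hpos : 0 < ‖φ w‖ + ‖ψ w‖ := by
    by_cases h0 : φ w = 0
    · have := norm_pos_iff.mpr (h.not_common_zero hφ hψ (hsub hw) h0)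
      positivity
    · have := norm_pos_iff.mpr h0
      positivity
  refine conditionC_iff.mpr ⟨min (1 / 2) (‖φ w‖ + ‖ψ w‖), lt_min (by norm_num) hpos,
    fun z hz => ?_⟩
  rcases le_or_gt ‖z‖ (max l 0) with hz1 | hz1
  · exact (min_le_right _ _).trans (hmin (by simpa using hz1))
  · have h2 := hl1 ⟨(le_max_left _ _).trans_lt hz1, mem_disk_iff.mp hz⟩ z rfl
    exact (min_le_left _ _).trans (h2.le.trans
      (max_le_add_of_nonneg (norm_nonneg _) (norm_nonneg _)))

/-! ### Inner functions are bounded by one -/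

/-- The integral bound that Cauchy's formula on a circle of radius `r` gives for `f z`. -/
theorem norm_le_integral_of_differentiableOn {f : ℂ → ℂ} (hf : DifferentiableOn ℂ f disk)
    {z : ℂ} {r : ℝ} (hr : r ∈ Ioo ‖z‖ 1) :
    (r - ‖z‖) * (2 * Real.pi * ‖f z‖) ≤ ∫ t in (0 : ℝ)..2 * Real.pi, ‖f (circleMap 0 r t)‖ := by
  have hr0 : 0 < r := (norm_nonneg z).trans_lt hr.1
  have hrz : 0 < r - ‖z‖ := sub_pos.mpr hr.1
  have hsub : Metric.closedBall (0 : ℂ) r ⊆ disk := Metric.closedBall_subset_ball hr.2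
  have hmem : ∀ t, circleMap 0 r t ∈ disk := circleMap_mem_disk ⟨hr0, hr.2⟩
  have hcont : Continuous fun t => ‖f (circleMap 0 r t)‖ :=
    (hf.continuousOn.comp_continuous (continuous_circleMap 0 r) hmem).norm
  have hC := (hf.mono hsub).circleIntegral_sub_inv_smul (w := z) (by simpa using hr.1)
  have hn := congrArg norm hC
  rw [smul_eq_mul, norm_mul, show ‖(2 * Real.pi * I : ℂ)‖ = 2 * Real.pi by
    simp [abs_of_pos Real.pi_pos], circleIntegral] at hn
  rw [← hn]
  have hle : ‖∫ t in (0 : ℝ)..2 * Real.pi, deriv (circleMap 0 r) t •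
      (circleMap 0 r t - z)⁻¹ • f (circleMap 0 r t)‖ ≤
      ∫ t in (0 : ℝ)..2 * Real.pi, (r - ‖z‖)⁻¹ * ‖f (circleMap 0 r t)‖ := by
    refine intervalIntegral.norm_integral_le_of_norm_le Real.two_pi_pos.le
      (Eventually.of_forall fun t _ => ?_) ((continuous_const.mul hcont).intervalIntegrable _ _)
    have h1 : r - ‖z‖ ≤ ‖circleMap 0 r t - z‖ := by
      have := norm_sub_norm_le (circleMap 0 r t) z
      rwa [norm_circleMap_zero, abs_of_pos hr0] at this
    have h2 : ‖deriv (circleMap 0 r) t‖ ≤ 1 := by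
      rw [deriv_circleMap, norm_mul, norm_circleMap_zero, norm_I, mul_one, abs_of_pos hr0]
      exact hr.2.le
    rw [norm_smul, norm_smul, norm_inv]
    calc ‖deriv (circleMap 0 r) t‖ * (‖circleMap 0 r t - z‖⁻¹ * ‖f (circleMap 0 r t)‖)
        ≤ 1 * ((r - ‖z‖)⁻¹ * ‖f (circleMap 0 r t)‖) := by gcongr
      _ = _ := one_mul _
  rw [intervalIntegral.integral_const_mul] at hle
  calc _ ≤ (r - ‖z‖) * ((r - ‖z‖)⁻¹ * ∫ t in (0 : ℝ)..2 * Real.pi, ‖f (circleMap 0 r t)‖) := by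
        gcongr
    _ = _ := by rw [← mul_assoc, mul_inv_cancel₀ hrz.ne', one_mul]

/-- The Cauchy kernel loses a factor `1 / (1 - ‖z‖)`; applying the estimate to all powers of `f`
removes it. -/
theorem IsInner.norm_le_one {f : ℂ → ℂ} (hf : IsInner f) {z : ℂ} (hz : z ∈ disk) : ‖f z‖ ≤ 1 := by
  obtain ⟨M, hM⟩ := hf.isHInfty.bounded
  have hz1 := mem_disk_iff.mp hz
  have hpow : ∀ n : ℕ, (1 - ‖z‖) * ‖f z‖ ^ n ≤ 1 := by
    intro n
    have hlim : Tendsto (fun r : ℝ => ∫ t in (0 : ℝ)..2 * Real.pi, ‖f (circleMap 0 r t) ^ n‖)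
        (𝓝[<] 1) (𝓝 (∫ _ in (0 : ℝ)..2 * Real.pi, (1 : ℝ))) := by
      have hrad := (ae_restrict_iff' measurableSet_Ioc).mp hf.radial
      rw [← uIoc_of_le Real.two_pi_pos.le] at hrad
      refine intervalIntegral.tendsto_integral_filter_of_dominated_convergence (fun _ => M ^ n)
        ?_ ?_ intervalIntegrable_const ?_
      · filter_upwards [eventually_radius_mem_Ioo one_pos] with r hr
        exact ((hf.isHInfty.holomorphic.continuousOn.comp_continuous (continuous_circleMap 0 r)
          (circleMap_mem_disk hr)).pow n).norm.aestronglyMeasurable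
      · filter_upwards [eventually_radius_mem_Ioo one_pos] with r hr
        refine Eventually.of_forall fun t _ => ?_
        rw [norm_norm, norm_pow]
        exact pow_le_pow_left₀ (norm_nonneg _) (hM _ (circleMap_mem_disk hr t)) n
      · filter_upwards [hrad] with t ht htm
        obtain ⟨w, hw, hlim⟩ := ht htm
        simpa [hw] using (hlim.pow n).norm
    have hleft : Tendsto (fun r : ℝ => (r - ‖z‖) * (2 * Real.pi * ‖f z ^ n‖)) (𝓝[<] 1)
        (𝓝 ((1 - ‖z‖) * (2 * Real.pi * ‖f z ^ n‖))) :=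
      Tendsto.mono_left (Continuous.tendsto (by fun_prop) 1) nhdsWithin_le_nhds
    have hle := le_of_tendsto_of_tendsto hleft hlim (by
      filter_upwards [eventually_radius_mem_Ioo hz1] with r hr
      exact norm_le_integral_of_differentiableOn (hf.isHInfty.holomorphic.pow n) hr)
    rw [intervalIntegral.integral_const, norm_pow] at hle
    simp only [sub_zero, smul_eq_mul, mul_one] at hle
    have := Real.two_pi_pos
    nlinarith
  by_contra! hgt
  obtain ⟨n, hn⟩ := pow_unbounded_of_one_lt (1 / (1 - ‖z‖)) hgt
  rw [div_lt_iff₀ (sub_pos.mpr hz1)] at hn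
  linarith [hpow n]

/-! ### The corona condition implies relative primeness -/

theorem IsInner.inv {u : ℂ → ℂ} (hu : IsInner u) {η : ℝ} (hη : 0 < η)
    (h : ∀ z ∈ disk, η ≤ ‖u z‖) : IsInner fun z => (u z)⁻¹ where
  isHInfty := ⟨hu.isHInfty.holomorphic.inv fun z hz => norm_pos_iff.mp (hη.trans_le (h z hz)),
    η⁻¹, fun z hz => by rw [norm_inv]; exact inv_anti₀ hη (h z hz)⟩
  radial := by
    filter_upwards [hu.radial] with t ht
    obtain ⟨w, hw, hlim⟩ := ht
    exact ⟨w⁻¹, by simp [hw], hlim.inv₀ (norm_pos_iff.mp (by simp [hw]))⟩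

/-- An inner function bounded away from zero is constant: both it and its reciprocal are bounded
by one. -/
theorem IsInner.eq_const_of_le_norm {u : ℂ → ℂ} (hu : IsInner u) {η : ℝ} (hη : 0 < η)
    (h : ∀ z ∈ disk, η ≤ ‖u z‖) : ∃ c, ∀ z ∈ disk, u z = c := by
  have h0 : (0 : ℂ) ∈ disk := by simp [disk]
  have h1 := (hu.inv hη h).norm_le_one h0
  rw [norm_inv] at h1
  have h2 : 1 ≤ ‖u 0‖ := by
    have hp := hη.trans_le (h 0 h0)
    rwa [inv_le_one₀ hp] at h1
  refine ⟨u 0, fun z hz => Complex.eqOn_of_isPreconnected_of_isMaxOn_norm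
    (convex_ball (0 : ℂ) 1).isPreconnected isOpen_disk hu.isHInfty.holomorphic h0 ?_ hz⟩
  exact fun w hw => (hu.norm_le_one hw).trans h2

theorem ConditionC.relativelyPrime {φ ψ : ℂ → ℂ} (hC : ConditionC φ ψ) : RelativelyPrime φ ψ := by
  rintro u hu ⟨h, hh, hφ⟩ ⟨k, hk, hψ⟩
  obtain ⟨δ, hδ, hle⟩ := conditionC_iff.mp hC
  obtain ⟨M, hM⟩ := hh.bounded
  obtain ⟨N, hN⟩ := hk.bounded
  have h0 : (0 : ℂ) ∈ disk := by simp [disk]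
  have hM0 := (norm_nonneg _).trans (hM 0 h0)
  have hN0 := (norm_nonneg _).trans (hN 0 h0)
  refine hu.eq_const_of_le_norm (η := δ / (M + N + 1)) (by positivity) fun z hz => ?_
  rw [div_le_iff₀ (by positivity)]
  have h1 := hle z hz
  rw [hφ z hz, hψ z hz, norm_mul, norm_mul] at h1
  nlinarith [hM z hz, hN z hz, norm_nonneg (u z)]

/-! ### Blaschke products with positive zeros -/

theorem blaschkeFactor_ofReal {a : ℝ} (ha : 0 < a) (z : ℂ) :
    blaschkeFactor a z = diskAut a z := by
  have h : (a : ℂ) ≠ 0 := by exact_mod_cast ha.ne'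
  rw [blaschkeFactor, if_neg h, Complex.norm_of_nonneg ha.le, div_self h, one_mul, diskAut]

theorem norm_ofReal_lt_one {a : ℝ} (ha : a ∈ Ioo (0 : ℝ) 1) : ‖(a : ℂ)‖ < 1 := by
  rw [Complex.norm_of_nonneg ha.1.le]
  exact ha.2

theorem norm_blaschkeFactor_ofReal_le_one {a : ℝ} (ha : a ∈ Ioo (0 : ℝ) 1) {z : ℂ}
    (hz : ‖z‖ ≤ 1) : ‖blaschkeFactor a z‖ ≤ 1 := by
  rw [blaschkeFactor_ofReal ha.1]
  exact norm_diskAut_le_one (norm_ofReal_lt_one ha) hz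

theorem norm_blaschkeFactor_ofReal_sub_one_le {a : ℝ} (ha : a ∈ Ioo (0 : ℝ) 1) {z : ℂ}
    (hz : ‖z‖ ≤ 1) {δ : ℝ} (hδ : 0 < δ) (hδz : δ ≤ ‖1 - z‖) :
    ‖blaschkeFactor a z - 1‖ ≤ 4 / δ * (1 - a) := by
  have hne := one_sub_conj_mul_ne_zero (norm_ofReal_lt_one ha) hz
  have heq : blaschkeFactor a z - 1 = -((1 - a : ℝ) * (1 + z)) / (1 - a * z) := by
    rw [blaschkeFactor_ofReal ha.1, diskAut]
    rw [conj_ofReal] at hne ⊢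
    rw [div_sub_one hne]
    push_cast
    ring
  have haz : ‖(a : ℂ) * z‖ ≤ a := by
    rw [norm_mul, Complex.norm_of_nonneg ha.1.le]
    exact mul_le_of_le_one_right ha.1.le hz
  have h1a : 0 < 1 - a := sub_pos.mpr ha.2
  have hden : 1 - a ≤ ‖1 - (a : ℂ) * z‖ := by
    have := norm_sub_norm_le 1 ((a : ℂ) * z)
    rw [norm_one] at this
    linarith
  have hden2 : δ / 2 ≤ ‖1 - (a : ℂ) * z‖ := by
    have h1 : ‖1 - z‖ ≤ ‖1 - (a : ℂ) * z‖ + ‖((1 - a : ℝ) : ℂ) * z‖ := by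
      refine le_trans (le_of_eq ?_) (norm_sub_le _ _)
      congr 1
      push_cast
      ring
    have h2 : ‖((1 - a : ℝ) : ℂ) * z‖ ≤ 1 - a := by
      rw [norm_mul, Complex.norm_of_nonneg h1a.le]
      exact mul_le_of_le_one_right h1a.le hz
    linarith
  have hnum : ‖1 + z‖ ≤ 2 := by
    have := norm_add_le 1 z
    rw [norm_one] at this
    linarith
  rw [heq, norm_div, norm_neg, norm_mul, Complex.norm_of_nonneg h1a.le]
  calc (1 - a) * ‖1 + z‖ / ‖1 - (a : ℂ) * z‖ ≤ (1 - a) * 2 / (δ / 2) := by gcongr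
    _ = 4 / δ * (1 - a) := by field_simp; norm_num

/-- The Blaschke product with zeros at the positive real numbers `a n`. -/
noncomputable def realBlaschke (a : ℕ → ℝ) (z : ℂ) : ℂ := ∏' n, blaschkeFactor (a n) z

/-- The closed disk without a neighbourhood of the point `1`, at which positive zeros
accumulate. -/
def slitDisk (δ : ℝ) : Set ℂ := Metric.closedBall 0 1 ∩ {z | δ ≤ ‖1 - z‖}

theorem isCompact_slitDisk (δ : ℝ) : IsCompact (slitDisk δ) :=
  (isCompact_closedBall 0 1).inter_right (isClosed_le (by fun_prop) (by fun_prop))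

theorem setOf_lt_norm_one_sub_mem_nhds {δ : ℝ} {z : ℂ} (hδz : δ < ‖1 - z‖) :
    {w : ℂ | δ < ‖1 - w‖} ∈ 𝓝 z :=
  (isOpen_lt (by fun_prop) (by fun_prop)).mem_nhds hδz

theorem continuousOn_blaschkeFactor_ofReal {a : ℝ} (ha : a ∈ Ioo (0 : ℝ) 1) :
    ContinuousOn (blaschkeFactor a) (Metric.closedBall 0 1) := by
  rw [funext (blaschkeFactor_ofReal ha.1)]
  exact continuousOn_diskAut (norm_ofReal_lt_one ha)

theorem differentiableOn_blaschkeFactor_ofReal {a : ℝ} (ha : a ∈ Ioo (0 : ℝ) 1) :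
    DifferentiableOn ℂ (blaschkeFactor a) disk := by
  rw [funext (blaschkeFactor_ofReal ha.1)]
  exact differentiableOn_diskAut (norm_ofReal_lt_one ha)

theorem hasProdUniformlyOn_realBlaschke {a : ℕ → ℝ} (ha : ∀ n, a n ∈ Ioo (0 : ℝ) 1)
    (hs : Summable fun n => 1 - a n) {δ : ℝ} (hδ : 0 < δ) :
    HasProdUniformlyOn (fun n z => blaschkeFactor (a n) z) (realBlaschke a) (slitDisk δ) := by
  have h := Summable.hasProdUniformlyOn_nat_one_add
    (f := fun n z => blaschkeFactor (a n) z - 1) (isCompact_slitDisk δ) (hs.mul_left (4 / δ))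
    (Eventually.of_forall fun n z hz => norm_blaschkeFactor_ofReal_sub_one_le (ha n)
      (by simpa using hz.1) hδ hz.2)
    (fun n => ((continuousOn_blaschkeFactor_ofReal (ha n)).mono inter_subset_left).sub
      continuousOn_const)
  simp only [add_sub_cancel] at h
  exact h

theorem exists_mem_slitDisk {z : ℂ} (hz : ‖z‖ ≤ 1) (hz1 : z ≠ 1) :
    ∃ δ > 0, δ < ‖1 - z‖ ∧ z ∈ slitDisk δ := by
  have h : 0 < ‖1 - z‖ := norm_pos_iff.mpr (sub_ne_zero.mpr hz1.symm)
  exact ⟨‖1 - z‖ / 2, half_pos h, half_lt_self h, by simpa using hz, (half_lt_self h).le⟩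

theorem hasProd_realBlaschke {a : ℕ → ℝ} (ha : ∀ n, a n ∈ Ioo (0 : ℝ) 1)
    (hs : Summable fun n => 1 - a n) {z : ℂ} (hz : ‖z‖ ≤ 1) (hz1 : z ≠ 1) :
    HasProd (fun n => blaschkeFactor (a n) z) (realBlaschke a z) := by
  obtain ⟨δ, hδ, -, hmem⟩ := exists_mem_slitDisk hz hz1
  exact (hasProdUniformlyOn_realBlaschke ha hs hδ).hasProd hmem

theorem ne_one_of_mem_disk {z : ℂ} (hz : z ∈ disk) : z ≠ 1 := by
  rintro rfl
  simp [mem_disk_iff] at hz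

theorem isBlaschkeProduct_realBlaschke {a : ℕ → ℝ} (ha : ∀ n, a n ∈ Ioo (0 : ℝ) 1)
    (hs : Summable fun n => 1 - a n) :
    IsBlaschkeProduct (fun n => (a n : ℂ)) (realBlaschke a) where
  mem_disk n := mem_disk_iff.mpr (norm_ofReal_lt_one (ha n))
  summable := by
    refine hs.congr fun n => ?_
    rw [Complex.norm_of_nonneg (ha n).1.le]
  hasProd z hz := hasProd_realBlaschke ha hs (mem_disk_iff.mp hz).le (ne_one_of_mem_disk hz)

/-- A Blaschke product is dominated by each of its factors. -/
theorem norm_realBlaschke_le {a : ℕ → ℝ} (ha : ∀ n, a n ∈ Ioo (0 : ℝ) 1)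
    (hs : Summable fun n => 1 - a n) {z : ℂ} (hz : z ∈ disk) (n : ℕ) :
    ‖realBlaschke a z‖ ≤ ‖blaschkeFactor (a n) z‖ := by
  have hz1 := (mem_disk_iff.mp hz).le
  have h := (hasProd_realBlaschke ha hs hz1 (ne_one_of_mem_disk hz)).norm
  refine le_of_tendsto h ?_
  rw [SummationFilter.unconditional_filter]
  filter_upwards [eventually_ge_atTop {n}] with s hs
  rw [← Finset.mul_prod_erase s _ (Finset.singleton_subset_iff.mp hs)]
  exact mul_le_of_le_one_right (norm_nonneg _) (Finset.prod_le_one (fun _ _ => norm_nonneg _)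
    fun i _ => norm_blaschkeFactor_ofReal_le_one (ha i) hz1)

theorem norm_realBlaschke_eq_one {a : ℕ → ℝ} (ha : ∀ n, a n ∈ Ioo (0 : ℝ) 1)
    (hs : Summable fun n => 1 - a n) {z : ℂ} (hz : ‖z‖ = 1) (hz1 : z ≠ 1) :
    ‖realBlaschke a z‖ = 1 := by
  have h := (hasProd_realBlaschke ha hs hz.le hz1).norm
  have hf : ∀ n, ‖blaschkeFactor (a n) z‖ = 1 := fun n => by
    rw [blaschkeFactor_ofReal (ha n).1]
    exact norm_diskAut_eq_one (norm_ofReal_lt_one (ha n)) hz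
  simp only [hf] at h
  exact h.unique hasProd_one

theorem differentiableOn_realBlaschke {a : ℕ → ℝ} (ha : ∀ n, a n ∈ Ioo (0 : ℝ) 1)
    (hs : Summable fun n => 1 - a n) : DifferentiableOn ℂ (realBlaschke a) disk := by
  intro z hz
  obtain ⟨δ, hδ, hδz, -⟩ := exists_mem_slitDisk (mem_disk_iff.mp hz).le (ne_one_of_mem_disk hz)
  have hopen : IsOpen (disk ∩ {w : ℂ | δ < ‖1 - w‖}) :=
    isOpen_disk.inter (isOpen_lt (by fun_prop) (by fun_prop))
  have hsub : disk ∩ {w : ℂ | δ < ‖1 - w‖} ⊆ slitDisk δ := fun w hw =>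
    ⟨Metric.ball_subset_closedBall hw.1, (show δ < ‖1 - w‖ from hw.2).le⟩
  have hunif := ((hasProdUniformlyOn_realBlaschke ha hs hδ).mono hsub).tendstoUniformlyOn
  have hd := hunif.tendstoLocallyUniformlyOn.differentiableOn (Eventually.of_forall fun s =>
    DifferentiableOn.fun_finsetProd fun n _ =>
      (differentiableOn_blaschkeFactor_ofReal (ha n)).mono inter_subset_left) hopen
  exact (hd.differentiableAt (hopen.mem_nhds ⟨hz, hδz⟩)).differentiableWithinAt

theorem continuousOn_realBlaschke {a : ℕ → ℝ} (ha : ∀ n, a n ∈ Ioo (0 : ℝ) 1)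
    (hs : Summable fun n => 1 - a n) {δ : ℝ} (hδ : 0 < δ) :
    ContinuousOn (realBlaschke a) (slitDisk δ) :=
  (hasProdUniformlyOn_realBlaschke ha hs hδ).tendstoUniformlyOn.continuousOn
    (Frequently.of_forall fun _ => continuousOn_finsetProd _ fun n _ =>
      (continuousOn_blaschkeFactor_ofReal (ha n)).mono inter_subset_left)

theorem circleMap_ne_one {t : ℝ} (ht : t ∈ Ioo 0 (2 * Real.pi)) : circleMap 0 1 t ≠ 1 := by
  intro h
  rw [circleMap_zero, ofReal_one, one_mul, Complex.exp_eq_one_iff] at h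
  obtain ⟨n, hn⟩ := h
  have h1 : t = n * (2 * Real.pi) := by simpa using congrArg Complex.im hn
  have hpi := Real.two_pi_pos
  have h2 : (0 : ℝ) < n := by
    by_contra! hneg
    nlinarith [ht.1]
  have h3 : (n : ℝ) < 1 := by
    by_contra! hge
    nlinarith [ht.2]
  have h4 : 0 < n := by exact_mod_cast h2
  have h5 : n < 1 := by exact_mod_cast h3
  omega

/-- The product extends continuously, with modulus one, to every point of the circle except `1`,
so all other radial limits exist. -/
theorem isInner_realBlaschke {a : ℕ → ℝ} (ha : ∀ n, a n ∈ Ioo (0 : ℝ) 1)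
    (hs : Summable fun n => 1 - a n) : IsInner (realBlaschke a) where
  isHInfty := ⟨differentiableOn_realBlaschke ha hs, 1, fun _ hz =>
    (norm_realBlaschke_le ha hs hz 0).trans
      (norm_blaschkeFactor_ofReal_le_one (ha 0) (mem_disk_iff.mp hz).le)⟩
  radial := by
    rw [← restrict_Ioo_eq_restrict_Ioc]
    refine (ae_restrict_iff' measurableSet_Ioo).mpr (Eventually.of_forall fun t ht => ?_)
    have hne := circleMap_ne_one ht
    have hnorm : ‖circleMap 0 1 t‖ = 1 := by simp
    obtain ⟨δ, hδ, hδt, hmem⟩ := exists_mem_slitDisk hnorm.le hne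
    refine ⟨_, norm_realBlaschke_eq_one ha hs hnorm hne,
      (continuousOn_realBlaschke ha hs hδ _ hmem).tendsto.comp
        (tendsto_nhdsWithin_iff.mpr ⟨tendsto_circleMap_radius t, ?_⟩)⟩
    filter_upwards [eventually_radius_mem_Ioo one_pos,
      (tendsto_circleMap_radius t).eventually (setOf_lt_norm_one_sub_mem_nhds hδt)] with r hr hr2
    exact ⟨Metric.ball_subset_closedBall (circleMap_mem_disk hr t), le_of_lt hr2⟩

/-! ### Lower bounds for geometric zero sequences -/

/-- The modulus of a factor is bounded below by a quantity that only depends on `‖1 - z‖`. -/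
theorem le_norm_blaschkeFactor {a : ℝ} (ha : a ∈ Ioo (0 : ℝ) 1) {z : ℂ} (hz : z ∈ disk) :
    |‖1 - z‖ - (1 - a)| / (‖1 - z‖ + (1 - a)) ≤ ‖blaschkeFactor a z‖ := by
  have h1a : 0 < 1 - a := sub_pos.mpr ha.2
  have hne := one_sub_conj_mul_ne_zero (norm_ofReal_lt_one ha) (mem_disk_iff.mp hz).le
  rw [blaschkeFactor_ofReal ha.1, diskAut, norm_div]
  rw [conj_ofReal] at hne ⊢
  have hnum : |‖1 - z‖ - (1 - a)| ≤ ‖(a : ℂ) - z‖ := by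
    have := abs_norm_sub_norm_le (1 - z) ((1 - a : ℝ) : ℂ)
    have h2 : 1 - z - ((1 - a : ℝ) : ℂ) = a - z := by
      push_cast
      ring
    rwa [Complex.norm_of_nonneg h1a.le, h2] at this
  have hden : ‖1 - (a : ℂ) * z‖ ≤ ‖1 - z‖ + (1 - a) := by
    have h1 := norm_add_le ((a : ℂ) * (1 - z)) ((1 - a : ℝ) : ℂ)
    rw [Complex.norm_of_nonneg h1a.le, norm_mul, Complex.norm_of_nonneg ha.1.le] at h1
    have h2 : (a : ℂ) * (1 - z) + ((1 - a : ℝ) : ℂ) = 1 - (a : ℂ) * z := by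
      push_cast
      ring
    rw [h2] at h1
    nlinarith [mul_le_of_le_one_left (norm_nonneg (1 - z)) ha.2.le]
  exact div_le_div₀ (norm_nonneg _) hnum (norm_pos_iff.mpr hne) hden

/-- The sum of `1 - t ^ 2` over `t = (s - ε n) / (s + ε n)` is bounded independently of `s`: its
terms are dominated by the increments of `n ↦ s / (s + ε n)`. -/
theorem sum_geometric_le {ε : ℕ → ℝ} (hε : ∀ n, 0 < ε n) (hgeom : ∀ n, ε (n + 1) = ε n / 4)
    {s : ℝ} (hs : 0 < s) (N : ℕ) :
    ∑ n ∈ Finset.range N, 4 * s * ε n / (s + ε n) ^ 2 ≤ 16 / 3 := by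
  have hstep : ∀ n, 4 * s * ε n / (s + ε n) ^ 2 ≤
      16 / 3 * (s / (s + ε (n + 1)) - s / (s + ε n)) := by
    intro n
    have hn := hε n
    rw [hgeom]
    have heq : 16 / 3 * (s / (s + ε n / 4) - s / (s + ε n)) =
        4 * s * ε n / ((s + ε n / 4) * (s + ε n)) := by
      field_simp
      ring
    rw [heq, sq]
    gcongr
    linarith
  calc _ ≤ ∑ n ∈ Finset.range N, 16 / 3 * (s / (s + ε (n + 1)) - s / (s + ε n)) :=
        Finset.sum_le_sum fun n _ => hstep n
    _ = 16 / 3 * (s / (s + ε N) - s / (s + ε 0)) := by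
      rw [← Finset.mul_sum, Finset.sum_range_sub fun n => s / (s + ε n)]
    _ ≤ 16 / 3 := by
      have h1 : s / (s + ε N) ≤ 1 := div_le_one_of_le₀ (by linarith [hε N]) (by linarith [hε N])
      have h2 : 0 ≤ s / (s + ε 0) := div_nonneg hs.le (by linarith [hε 0])
      linarith

theorem exp_neg_sum_le_prod {ι : Type*} (S : Finset ι) {x : ι → ℝ} {c : ℝ} (hc : 0 < c)
    (hx : ∀ i ∈ S, x i ∈ Icc c 1) :
    Real.exp (-((∑ i ∈ S, (1 - x i)) / c)) ≤ ∏ i ∈ S, x i := by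
  rw [Finset.sum_div, ← Finset.sum_neg_distrib, Real.exp_sum]
  refine Finset.prod_le_prod (fun _ _ => (Real.exp_pos _).le) fun i hi => ?_
  obtain ⟨h1, h2⟩ := hx i hi
  have hpos := hc.trans_le h1
  rw [← Real.le_log_iff_exp_le hpos]
  refine le_trans ?_ (Real.one_sub_inv_le_log_of_pos hpos)
  have h3 : (1 - x i) / x i ≤ (1 - x i) / c :=
    div_le_div_of_nonneg_left (sub_nonneg.mpr h2) hc h1
  have h4 : (1 - x i) / x i = (x i)⁻¹ - 1 := by field_simp
  linarith

theorem exp_neg_le_prod_geometric {ε : ℕ → ℝ} (hε : ∀ n, 0 < ε n)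
    (hgeom : ∀ n, ε (n + 1) = ε n / 4) {s : ℝ} (hs : 0 < s)
    (hsep : ∀ n, 1 / 7 ≤ |s - ε n| / (s + ε n)) (N : ℕ) :
    Real.exp (-(16 / 3 / (1 / 7) ^ 2)) ≤ ∏ n ∈ Finset.range N, |s - ε n| / (s + ε n) := by
  have hle1 : ∀ n, |s - ε n| / (s + ε n) ≤ 1 := fun n => by
    have := hε n
    apply div_le_one_of_le₀ _ (by positivity)
    exact abs_le.mpr ⟨by linarith, by linarith⟩
  have hnn : ∀ n, 0 ≤ |s - ε n| / (s + ε n) := fun n => le_trans (by norm_num) (hsep n)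
  have hsq : ∀ n, 1 - (|s - ε n| / (s + ε n)) ^ 2 = 4 * s * ε n / (s + ε n) ^ 2 := by
    intro n
    have := hε n
    rw [div_pow, sq_abs]
    field_simp
    ring
  -- The squares have the computable defect `hsq`, and `t ^ 2 ≤ t` for the factors themselves.
  have h1 := exp_neg_sum_le_prod (Finset.range N)
    (x := fun n => (|s - ε n| / (s + ε n)) ^ 2) (c := (1 / 7) ^ 2) (by norm_num)
    (fun n _ => ⟨pow_le_pow_left₀ (by norm_num) (hsep n) 2, pow_le_one₀ (hnn n) (hle1 n)⟩)
  simp only [hsq] at h1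
  refine le_trans (Real.exp_le_exp.mpr ?_) (h1.trans ?_)
  · exact neg_le_neg (div_le_div_of_nonneg_right (sum_geometric_le hε hgeom hs N) (by norm_num))
  · exact Finset.prod_le_prod (fun n _ => by positivity)
      fun n _ => pow_le_of_le_one (hnn n) (hle1 n) two_ne_zero

theorem le_norm_realBlaschke {a : ℕ → ℝ} (ha : ∀ n, a n ∈ Ioo (0 : ℝ) 1)
    (hs : Summable fun n => 1 - a n) (hgeom : ∀ n, 1 - a (n + 1) = (1 - a n) / 4) {z : ℂ}
    (hz : z ∈ disk)
    (hsep : ∀ n, 1 / 7 ≤ |‖1 - z‖ - (1 - a n)| / (‖1 - z‖ + (1 - a n))) :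
    Real.exp (-(16 / 3 / (1 / 7) ^ 2)) ≤ ‖realBlaschke a z‖ := by
  have hz1 := ne_one_of_mem_disk hz
  have h := (hasProd_realBlaschke ha hs (mem_disk_iff.mp hz).le hz1).tendsto_prod_nat.norm
  refine ge_of_tendsto' h fun N => ?_
  rw [norm_prod]
  refine (exp_neg_le_prod_geometric (ε := fun n => 1 - a n) (fun n => sub_pos.mpr (ha n).2) hgeom
    (norm_pos_iff.mpr (sub_ne_zero.mpr hz1.symm)) hsep N).trans ?_
  refine Finset.prod_le_prod (fun n _ => le_trans (by norm_num) (hsep n)) fun n _ => ?_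
  exact le_norm_blaschkeFactor (ha n) hz

/-! ### Two interlaced geometric zero sequences -/

theorem one_sub_geometric_mem_Ioo {κ : ℝ} (hκ : κ ∈ Icc (1 : ℝ) 2) (n : ℕ) :
    1 - κ * (1 / 4) ^ (n + 1) ∈ Ioo (0 : ℝ) 1 := by
  have h1 : (0 : ℝ) < (1 / 4) ^ (n + 1) := by positivity
  have h2 : (1 / 4 : ℝ) ^ (n + 1) ≤ 1 / 4 :=
    pow_le_of_le_one (by norm_num) (by norm_num) n.succ_ne_zero
  constructor <;> nlinarith [hκ.1, hκ.2]

theorem summable_geometric_gap (κ : ℝ) :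
    Summable fun n : ℕ => 1 - (1 - κ * (1 / 4) ^ (n + 1)) := by
  simp only [sub_sub_cancel]
  exact ((summable_nat_add_iff 1).mpr
    (summable_geometric_of_lt_one (by norm_num) (by norm_num))).mul_left κ

theorem geometric_gap_succ (κ : ℝ) (n : ℕ) :
    1 - (1 - κ * (1 / 4) ^ (n + 1 + 1)) = (1 - (1 - κ * (1 / 4) ^ (n + 1))) / 4 := by
  ring

theorem ratio_bounds_of_lt {s ε : ℝ} (hs : 0 < s) (hε : 0 < ε)
    (h : |s - ε| / (s + ε) < 1 / 7) : 3 * s < 4 * ε ∧ 3 * ε < 4 * s := by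
  rw [div_lt_iff₀ (by positivity), abs_lt] at h
  constructor <;> linarith

/-- No `s > 0` is close, in the multiplicative sense, both to a term `4 ^ (-n)` and to a term
`2 * 4 ^ (-m)`: being close with constant `1 / 7` puts the ratio in `(3 / 4, 4 / 3)`, and terms of
the two sequences differ by a factor of at least `2 > (4 / 3) ^ 2`. -/
theorem separated_or_separated {s : ℝ} (hs : 0 < s) :
    (∀ n : ℕ, 1 / 7 ≤ |s - (1 / 4) ^ (n + 1)| / (s + (1 / 4) ^ (n + 1))) ∨
      ∀ n : ℕ, 1 / 7 ≤ |s - 2 * (1 / 4) ^ (n + 1)| / (s + 2 * (1 / 4) ^ (n + 1)) := by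
  by_contra! h
  obtain ⟨⟨n, hn⟩, m, hm⟩ := h
  obtain ⟨h1, h2⟩ := ratio_bounds_of_lt hs (by positivity) hn
  obtain ⟨h3, h4⟩ := ratio_bounds_of_lt hs (by positivity) hm
  rcases le_or_gt m n with hmn | hmn
  · have : (1 / 4 : ℝ) ^ (n + 1) ≤ (1 / 4) ^ (m + 1) :=
      pow_le_pow_of_le_one (by norm_num) (by norm_num) (by omega)
    linarith
  · have : (1 / 4 : ℝ) ^ (m + 1) ≤ (1 / 4) ^ (n + 1 + 1) :=
      pow_le_pow_of_le_one (by norm_num) (by norm_num) (by omega)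
    rw [pow_succ _ (n + 1)] at this
    linarith

/-- The Blaschke product with zeros `1 - κ * 4 ^ (-n)`, `n ≥ 1`. -/
noncomputable def geometricBlaschke (κ : ℝ) : ℂ → ℂ :=
  realBlaschke fun n => 1 - κ * (1 / 4) ^ (n + 1)

theorem conditionC_geometricBlaschke : ConditionC (geometricBlaschke 1) (geometricBlaschke 2) := by
  refine conditionC_iff.mpr ⟨_, Real.exp_pos (-(16 / 3 / (1 / 7) ^ 2)), fun z hz => ?_⟩
  have hpos : 0 < ‖1 - z‖ := norm_pos_iff.mpr (sub_ne_zero.mpr (ne_one_of_mem_disk hz).symm)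
  rcases separated_or_separated hpos with h | h
  · refine le_add_of_le_of_nonneg (le_norm_realBlaschke
      (one_sub_geometric_mem_Ioo ⟨le_rfl, one_le_two⟩) (summable_geometric_gap 1)
      (geometric_gap_succ 1) hz fun n => ?_) (norm_nonneg _)
    simpa using h n
  · refine le_add_of_nonneg_of_le (norm_nonneg _) (le_norm_realBlaschke
      (one_sub_geometric_mem_Ioo ⟨one_le_two, le_rfl⟩) (summable_geometric_gap 2)
      (geometric_gap_succ 2) hz fun n => ?_)
    simpa only [sub_sub_cancel] using h n

/-- At the zero `a = 1 - ε` of the first product, the factor of the second one with zero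
`b = 1 - 2 * ε` has modulus `(a - b) / (1 - a * b) = 1 / (3 - 2 * ε)`. -/
theorem norm_geometricBlaschke_le (n : ℕ) :
    max ‖geometricBlaschke 1 ((1 - 1 * (1 / 4) ^ (n + 1) : ℝ) : ℂ)‖
      ‖geometricBlaschke 2 ((1 - 1 * (1 / 4) ^ (n + 1) : ℝ) : ℂ)‖ ≤ 2 / 5 := by
  have ha := one_sub_geometric_mem_Ioo (κ := 1) ⟨le_rfl, one_le_two⟩
  have hb := one_sub_geometric_mem_Ioo (κ := 2) ⟨one_le_two, le_rfl⟩
  have hmem : ((1 - 1 * (1 / 4) ^ (n + 1) : ℝ) : ℂ) ∈ disk :=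
    mem_disk_iff.mpr (norm_ofReal_lt_one (ha n))
  refine max_le ?_ ?_
  · refine (norm_realBlaschke_le ha (summable_geometric_gap 1) hmem n).trans ?_
    rw [blaschkeFactor_ofReal (ha n).1, diskAut, sub_self, zero_div, norm_zero]
    norm_num
  · refine (norm_realBlaschke_le hb (summable_geometric_gap 2) hmem n).trans ?_
    rw [blaschkeFactor_ofReal (hb n).1, diskAut, conj_ofReal]
    have h1 : (0 : ℝ) < (1 / 4) ^ (n + 1) := by positivity
    have h2 : (1 / 4 : ℝ) ^ (n + 1) ≤ 1 / 4 :=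
      pow_le_of_le_one (by norm_num) (by norm_num) n.succ_ne_zero
    generalize (1 / 4 : ℝ) ^ (n + 1) = ε at h1 h2
    have heq : (((1 - 2 * ε : ℝ) : ℂ) - ((1 - 1 * ε : ℝ) : ℂ)) /
        (1 - ((1 - 2 * ε : ℝ) : ℂ) * ((1 - 1 * ε : ℝ) : ℂ)) =
        ((-ε / (ε * (3 - 2 * ε)) : ℝ) : ℂ) := by
      push_cast
      congr 1 <;> ring
    rw [heq, norm_real, Real.norm_eq_abs, neg_div, abs_neg, abs_of_nonneg
      (div_nonneg h1.le (mul_nonneg h1.le (by linarith))),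
      div_le_div_iff₀ (by nlinarith) (by norm_num)]
    nlinarith

theorem not_conditionS_geometricBlaschke :
    ¬ ConditionS (geometricBlaschke 1) (geometricBlaschke 2) := by
  intro hS
  have hlim : Tendsto (fun n : ℕ => ((1 - 1 * (1 / 4) ^ (n + 1) : ℝ) : ℂ)) atTop
      (comap (fun z : ℂ => ‖z‖) (𝓝[<] 1)) := by
    have ha := one_sub_geometric_mem_Ioo (κ := 1) ⟨le_rfl, one_le_two⟩
    refine tendsto_comap_iff.mpr (tendsto_nhdsWithin_iff.mpr ⟨?_, Eventually.of_forall fun n =>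
      norm_ofReal_lt_one (ha n)⟩)
    have h0 : Tendsto (fun n : ℕ => (1 / 4 : ℝ) ^ (n + 1)) atTop (𝓝 0) :=
      (tendsto_pow_atTop_nhds_zero_of_lt_one (by norm_num) (by norm_num)).comp
        (tendsto_add_atTop_nat 1)
    have h1 : Tendsto (fun n : ℕ => 1 - 1 * (1 / 4 : ℝ) ^ (n + 1)) atTop (𝓝 1) := by
      simpa using (h0.const_mul 1).const_sub 1
    exact h1.congr fun n => (Complex.norm_of_nonneg (ha n).1.le).symm
  have hle := le_of_tendsto' (hS.comp hlim) norm_geometricBlaschke_le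
  norm_num at hle

end DiskInner

theorem proposition2p4 :
    (∀ φ ψ : ℂ → ℂ, DiskInner.IsInner φ → DiskInner.IsInner ψ →
      DiskInner.RelativelyPrime φ ψ →
      DiskInner.ConditionS φ ψ → DiskInner.ConditionC φ ψ) ∧
    (∃ B₁ B₂ : ℂ → ℂ,
      DiskInner.IsBlaschkeProduct (fun n : ℕ => 1 - (1 / 4 : ℂ) ^ (n + 1)) B₁ ∧
      DiskInner.IsBlaschkeProduct (fun n : ℕ => 1 - 2 * (1 / 4 : ℂ) ^ (n + 1)) B₂ ∧
      DiskInner.IsInner B₁ ∧ DiskInner.IsInner B₂ ∧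
      DiskInner.RelativelyPrime B₁ B₂ ∧
      DiskInner.ConditionC B₁ B₂ ∧ ¬ DiskInner.ConditionS B₁ B₂) := by
  have ha := DiskInner.one_sub_geometric_mem_Ioo (κ := 1) ⟨le_rfl, one_le_two⟩
  have hb := DiskInner.one_sub_geometric_mem_Ioo (κ := 2) ⟨one_le_two, le_rfl⟩
  have hsa := DiskInner.summable_geometric_gap 1
  have hsb := DiskInner.summable_geometric_gap 2
  refine ⟨fun φ ψ hφ hψ hprime hS => hS.conditionC hφ.isHInfty hψ.isHInfty hprime,
    DiskInner.geometricBlaschke 1, DiskInner.geometricBlaschke 2, ?_, ?_,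
    DiskInner.isInner_realBlaschke ha hsa, DiskInner.isInner_realBlaschke hb hsb,
    DiskInner.conditionC_geometricBlaschke.relativelyPrime,
    DiskInner.conditionC_geometricBlaschke, DiskInner.not_conditionS_geometricBlaschke⟩
  · convert DiskInner.isBlaschkeProduct_realBlaschke ha hsa using 2 with n
    · push_cast
      ring
    · rfl
  · convert DiskInner.isBlaschkeProduct_realBlaschke hb hsb using 2 with n
    · push_cast
      ring
    · rfl
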